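/- Let $d\ge 0$, $m\ge 2$ and $0\le k<m$ be integers. Throughout, $K$ denotes a field in which $m\ne 0$, and $\overline K$ an algebraic closure of $K$. For $\mathbf c=(c_0,\dots,c_d)\in K^{d+1}$ put $F_{\mathbf c}(X,Y)=\sum_{i=0}^d c_iX^{d-i}Y^i$ and $F_{\mathbf c}(z)=F_{\mathbf c}(z,1)$. Let $$\mathrm{Rat}_d(K)=\{[\mathbf a,\mathbf b]\in\mathbb P^{2d+1}(K):\operatorname{Res}(F_{\mathbf a},F_{\mathbf b})\ne 0\},$$ where the resultant is that of two forms of degree $d$, and for $F_{\mathbf b}\neq 0$ let $\varphi_{\mathbf a,\mathbf b}(z)=F_{\mathbf a}(z)/F_{\mathbf b}(z)\in K(z)$. The form $F_{\mathbf b}$ is called $m$-nondegenerate if $F_{\mathbf b}(z)$ has degree exactly $d$, its roots in $\overline K$ are nonzero, and any two roots $\gamma,\gamma'$ satisfy $\gamma=\gamma'$ or $\gamma^m\ne\gamma'^m$. Let $\mathrm{Rat}_d^{m\text{-nondeg}}(K)$ be the set of $[\mathbf a,\mathbf b]\in\mathrm{Rat}_d(K)$ for which $F_{\mathbf b}$ is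 $m$-nondegenerate. (a) $\mathrm{Rat}_d^{m\text{-nondeg}}$ is the complement of a hypersurface in $\mathbb P^{2d+1}$: there is a homogeneous polynomial $f\in\mathbb Z[a_0,\dots,a_d,b_0,\dots,b_d]$ of positive degree, depending only on $d$ and $m$, such that for every field $K$ in which $m\neq 0$ the image of $f$ in $K[\mathbf a,\mathbf b]$ is nonzero and $\mathrm{Rat}_d^{m\text{-nondeg}}(K)=\{[\mathbf a,\mathbf b]\in\mathbb P^{2d+1}(K): f(\mathbf a,\mathbf b)\ne 0\}$. (b) For every such $K$ and every $[\mathbf a,\mathbf b]\in\mathrm{Rat}_d^{m\text{-nondeg}}(K)$, the $(m,k)$-Landen transform $\mathfrak F_{m,k}(\varphi_{\mathbf a,\mathbf b})\in K(z)$, that is, the unique $\psi\in K(z)$ satisfying $$\psi(w^m)=\frac1{mw^k}\sum_{t=0}^{m-1}\zeta_m^{-kt}\,\varphi_{\mathbf a,\mathbf b}(\zeta_m^tw)\quad\text{in }\overline K(w)$$ for every primitive $m$-th root of unity $\zeta_m\in\overline K$, exists and has degree exactly $d$, where the degree of a rational function is the maximum of the degrees of its numerator and denominator in lowest terms. -/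

import Mathlib

namespace Landen

open Polynomial

/-- Index set for the homogeneous coordinates `[a₀, …, a_d, b₀, …, b_d]` of `ℙ^(2d+1)`:
`Sum.inl i` stands for `a_i` and `Sum.inr i` for `b_i`. -/
abbrev Coord (d : ℕ) : Type := Fin (d + 1) ⊕ Fin (d + 1)

/-- The `K`-points of projective space of dimension `2d+1`. -/
abbrev ProjSpace (K : Type*) [Field K] (d : ℕ) : Type _ :=
  Projectivization K (Coord d → K)

/-- The dehomogenized binary form
`F_c(z) = F_c(z, 1) = c₀ z^d + c₁ z^(d-1) + ⋯ + c_d`. -/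
noncomputable def form {K : Type*} [Field K] {d : ℕ} (c : Fin (d + 1) → K) : K[X] :=
  ∑ i : Fin (d + 1), C (c i) * X ^ (d - (i : ℕ))

/-- The numerator `F_a` of a point `[a, b]` (for a chosen representative). -/
noncomputable def numer {K : Type*} [Field K] {d : ℕ} (P : ProjSpace K d) : K[X] :=
  form fun i => P.rep (Sum.inl i)

/-- The denominator `F_b` of a point `[a, b]` (for the same representative). -/
noncomputable def denomin {K : Type*} [Field K] {d : ℕ} (P : ProjSpace K d) : K[X] :=
  form fun i => P.rep (Sum.inr i)

/-- The rational function `F_a(z) / F_b(z)` attached to the point `[a, b]`; it does not depend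
on the representative. -/
noncomputable def ratFunc {K : Type*} [Field K] {d : ℕ} (P : ProjSpace K d) : RatFunc K :=
  algebraMap K[X] (RatFunc K) (numer P) / algebraMap K[X] (RatFunc K) (denomin P)

/-- `Rat_d` inside `ℙ^(2d+1)`: the points at which the resultant of `F_a` and `F_b`, both taken
as forms of degree `d`, does not vanish. -/
def Rat (K : Type*) [Field K] (d : ℕ) : Set (ProjSpace K d) :=
  {P | resultant (numer P) (denomin P) d d ≠ 0}

/-- A form of degree `d` with dehomogenization `p = F(z, 1)` is `m`-nondegenerate if `p` has degree
exactly `d`, its roots in an algebraic closure are nonzero, and any two of these roots are equal or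
have different `m`-th powers. -/
def IsNondegenerate {K : Type*} [Field K] (d m : ℕ) (p : K[X]) : Prop :=
  p.degree = (d : WithBot ℕ) ∧
    (∀ x ∈ p.aroots (AlgebraicClosure K), x ≠ 0) ∧
    ∀ x ∈ p.aroots (AlgebraicClosure K), ∀ y ∈ p.aroots (AlgebraicClosure K),
      x = y ∨ x ^ m ≠ y ^ m

/-- The points of `Rat_d` with `m`-nondegenerate denominator. -/
def RatNondeg (K : Type*) [Field K] (d m : ℕ) : Set (ProjSpace K d) :=
  {P | P ∈ Rat K d ∧ IsNondegenerate d m (denomin P)}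

/-- The zero locus in `ℙ^(2d+1)(K)` of a homogeneous polynomial. -/
def zeroLocus {K : Type*} [Field K] {d : ℕ} (f : MvPolynomial (Coord d) K) :
    Set (ProjSpace K d) :=
  {P | MvPolynomial.eval P.rep f = 0}

/-- Substitution `φ(u)` of an element `u` of `K̄(w)` into `φ ∈ K(z)`. -/
noncomputable def subst {K : Type*} [Field K] (φ : RatFunc K)
    (u : RatFunc (AlgebraicClosure K)) : RatFunc (AlgebraicClosure K) :=
  φ.eval (RatFunc.C.comp (algebraMap K (AlgebraicClosure K))) u

/-- `ψ` is the `(m, k)`-Landen transform of `φ`: for every primitive `m`-th root of unity `ζ`,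
`ψ(w^m) = (1 / (m w^k)) ∑_{t<m} ζ^(-kt) φ(ζ^t w)` in `K̄(w)`. -/
def IsLandenTransform {K : Type*} [Field K] (m k : ℕ) (φ ψ : RatFunc K) : Prop :=
  ∀ ζ : AlgebraicClosure K, IsPrimitiveRoot ζ m →
    subst ψ (RatFunc.X ^ m) =
      1 / ((m : RatFunc (AlgebraicClosure K)) * RatFunc.X ^ k) *
        ∑ t ∈ Finset.range m,
          RatFunc.C ((ζ ^ (k * t))⁻¹) * subst φ (RatFunc.C (ζ ^ t) * RatFunc.X)

/-- The degree of a rational function: the larger of the degrees of numerator and denominator in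
lowest terms. -/
noncomputable def ratDegree {K : Type*} [Field K] (φ : RatFunc K) : ℕ :=
  max φ.num.natDegree φ.denom.natDegree

end Landen

/-! Let `q = F_b` and `p = F_a`. Two nonzero elements have equal `m`-th powers exactly when they
differ by a factor `ζ^t`. So, once `q` has degree `d` and no root `0`, nondegeneracy says that `q`
has no common root with `G(x) = ∏_{0<t<m} q(ζ^t x)`. The product `G` is the resultant in `y` of
`(y^m - x^m)/(y - x)` and `q(y)`, hence is defined over `ℤ` without roots of unity (`conjProd`). The
hypersurface for (a) is therefore `Res(a, b) · b_0 · b_d · Res(b, G) = 0`; the factors are tested by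
`isNondegenerate_iff`.

For (b), write `φ = pG / (qG)`. The product `qG` runs over all `m` conjugates of `q`, so it is
invariant under `x ↦ ζx` and equals `H(x^m)` with `deg H = d`. The average then acts on `pG` alone
and keeps the exponents congruent to `k`, giving `ψ = N/H` with `N_n = (pG)_{nm+k}` and `deg N ≤ d`.
A root of `H` has the form `x^m` with `q(x) = 0`; at such an `x` only the term `t = 0` of the
average survives, so `m x^k N(x^m) = p(x) G(x)`. This is nonzero by coprimality and nondegeneracy,
so `N/H` is in lowest terms (`isCoprime_landenNumer`). Uniqueness holds because `w ↦ w^m` is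
injective on rational functions. -/

namespace Landen

open Polynomial

/-! ### Homogeneity of resultants -/

section Graded

variable {A σ : Type*} [CommRing A] [SetLike σ A] [AddSubgroupClass σ A] (𝒜 : ℕ → σ)
  [SetLike.GradedMonoid 𝒜]

/-- A determinant whose columns are homogeneous is homogeneous. -/
theorem det_mem_graded {n : Type*} [Fintype n] [DecidableEq n] (M : Matrix n n A) (c : n → ℕ)
    (h : ∀ i j, M i j ∈ 𝒜 (c j)) : M.det ∈ 𝒜 (∑ j, c j) := by
  rw [Matrix.det_apply]
  refine sum_mem fun s _ => ?_
  rw [Units.smul_def]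
  exact zsmul_mem (SetLike.prod_mem_graded 𝒜 _ _ fun j _ => h _ j) _

/-- The resultant of two polynomials with homogeneous coefficients is homogeneous. -/
theorem resultant_mem_graded {f g : A[X]} {p q : ℕ} (hf : ∀ i, f.coeff i ∈ 𝒜 p)
    (hg : ∀ i, g.coeff i ∈ 𝒜 q) (m n : ℕ) :
    resultant f g m n ∈ 𝒜 (m * q + n * p) := by
  -- The first `m` Sylvester columns hold coefficients of `g`, the other `n` those of `f`.
  have h := det_mem_graded 𝒜 (sylvester f g m n) (fun j => j.addCases (fun _ => q) (fun _ => p))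
    (fun i j => by
      induction j using Fin.addCases with
      | left j =>
        simp only [sylvester, Matrix.of_apply, Fin.addCases_left]
        split_ifs
        exacts [hg _, zero_mem _]
      | right j =>
        simp only [sylvester, Matrix.of_apply, Fin.addCases_right]
        split_ifs
        exacts [hf _, zero_mem _])
  simpa [resultant, Fin.sum_univ_add] using h

end Graded

/-- Polynomials all of whose coefficients are homogeneous of degree `e`. -/
def homogeneousCoeffs (σ R : Type*) [CommRing R] (e : ℕ) : AddSubgroup (MvPolynomial σ R)[X] where
  carrier := {f | ∀ i, (f.coeff i).IsHomogeneous e}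
  zero_mem' i := by simpa using MvPolynomial.isHomogeneous_zero σ R e
  add_mem' hf hg i := by simpa using (hf i).add (hg i)
  neg_mem' hf i := by simpa using (hf i).neg

theorem mem_homogeneousCoeffs {σ R : Type*} [CommRing R] {e : ℕ} {f : (MvPolynomial σ R)[X]} :
    f ∈ homogeneousCoeffs σ R e ↔ ∀ i, (f.coeff i).IsHomogeneous e := Iff.rfl

/-- The coefficientwise grading lets `resultant_mem_graded` apply to `conjProd`, a resultant whose
entries are themselves polynomials in `x`. -/
instance (σ R : Type*) [CommRing R] : SetLike.GradedMonoid (homogeneousCoeffs σ R) where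
  one_mem i := by
    rw [coeff_one]
    split_ifs
    exacts [MvPolynomial.isHomogeneous_one σ R, MvPolynomial.isHomogeneous_zero σ R 0]
  mul_mem a b f g hf hg i := by
    rw [coeff_mul]
    exact MvPolynomial.IsHomogeneous.sum _ _ _ fun x _ => (hf _).mul (hg _)

/-! ### Binary forms and the product of conjugates -/

/-- The binary form of degree `d` with coefficients `c`, dehomogenized. -/
noncomputable def binaryForm {R : Type*} [CommRing R] {d : ℕ} (c : Fin (d + 1) → R) : R[X] :=
  ∑ i : Fin (d + 1), C (c i) * X ^ (d - (i : ℕ))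

/-- `∑ x^i y^(m-1-i) = (y^m - x^m) / (y - x)` as a polynomial in `y` over `R[x]`. -/
noncomputable def geomForm (R : Type*) [CommRing R] (m : ℕ) : R[X][X] :=
  ∑ i ∈ Finset.range m, X ^ i * C X ^ (m - 1 - i)

/-- The product of the conjugates `q(ζ^t x)`, `0 < t < m`, written as a resultant. -/
noncomputable def conjProd {R : Type*} [CommRing R] (m d : ℕ) (q : R[X]) : R[X] :=
  resultant (geomForm R m) (q.map C) (m - 1) d

section Map

variable {R S : Type*} [CommRing R] [CommRing S] (φ : R →+* S)

theorem map_binaryForm {d : ℕ} (c : Fin (d + 1) → R) :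
    (binaryForm c).map φ = binaryForm fun i => φ (c i) := by
  simp [binaryForm, Polynomial.map_sum]

theorem map_geomForm (m : ℕ) : (geomForm R m).map (mapRingHom φ) = geomForm S m := by
  simp [geomForm, Polynomial.map_sum]

/-- Base change is what the resultant definition buys: `conjProd` is formed over `ℤ` and factored
only after passing to a field with roots of unity. -/
theorem map_conjProd (m d : ℕ) (q : R[X]) :
    (conjProd m d q).map φ = conjProd m d (q.map φ) := by
  have h : ((q.map C).map (mapRingHom φ)) = (q.map φ).map C := by
    rw [map_map, map_map]
    congr 1
    ext x
    simp
  rw [conjProd, ← coe_mapRingHom, ← resultant_map_map, map_geomForm, h, coe_mapRingHom, conjProd]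

theorem coeff_binaryForm {d : ℕ} (c : Fin (d + 1) → R) (n : ℕ) :
    (binaryForm c).coeff n = if h : n ≤ d then c ⟨d - n, by lia⟩ else 0 := by
  simp only [binaryForm, finsetSum_coeff, coeff_C_mul, coeff_X_pow, mul_ite, mul_one, mul_zero]
  split_ifs with h
  · rw [Finset.sum_eq_single ⟨d - n, by lia⟩]
    · rw [if_pos]
      simp only
      lia
    · intro b _ hb
      rw [if_neg]
      intro hn
      exact hb (Fin.ext (by simp only; lia))
    · simp
  · exact Finset.sum_eq_zero fun i _ => if_neg (by lia)

theorem natDegree_binaryForm_le {d : ℕ} (c : Fin (d + 1) → R) : (binaryForm c).natDegree ≤ d :=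
  natDegree_le_iff_coeff_eq_zero.2 fun n hn => by
    rw [coeff_binaryForm, dif_neg (by lia)]

theorem binaryForm_coeff {d : ℕ} (p : R[X]) (hp : p.natDegree ≤ d) :
    binaryForm (fun i : Fin (d + 1) => p.coeff (d - i)) = p := by
  ext n
  rw [coeff_binaryForm]
  split_ifs with h
  · simp only
    congr 1
    lia
  · rw [coeff_eq_zero_of_natDegree_lt (by lia)]

end Map

/-- The product of the conjugates over a field containing a primitive `m`-th root of unity. -/
theorem conjProd_eq_prod {L : Type*} [Field L] {m d : ℕ} (hm : 0 < m) {ζ : L}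
    (hζ : IsPrimitiveRoot ζ m) (q : L[X]) (hq : q.natDegree ≤ d) :
    conjProd m d q = ∏ t ∈ Finset.range (m - 1), q.comp (C (ζ ^ (t + 1)) * X) := by
  have hζ' : IsPrimitiveRoot (C ζ) m := hζ.map_of_injective C_injective
  have h1 := X_pow_sub_C_eq_prod hζ' (α := (X : L[X])) hm rfl
  have h2 : geomForm L m = ∏ t ∈ Finset.range (m - 1), (X - C (C (ζ ^ (t + 1)) * X)) := by
    have h3 : geomForm L m * (X - C X) = X ^ m - C X ^ m := by
      rw [geomForm]
      exact geom_sum₂_mul _ _ _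
    obtain ⟨m, rfl⟩ : ∃ m', m = m' + 1 := ⟨m - 1, by lia⟩
    -- The factor `t = 0` of `X^m - x^m` is `X - x`, exactly the one missing from `geomForm`.
    rw [Finset.prod_range_succ', C_pow, ← h3] at h1
    refine mul_right_cancel₀ (X_sub_C_ne_zero (X : L[X])) ?_
    simpa using h1
  have hmonic : (geomForm L m).Monic := by
    rw [h2]
    exact monic_prod_of_monic _ _ fun t _ => monic_X_sub_C _
  have hdeg : (geomForm L m).natDegree = m - 1 := by
    rw [h2, natDegree_prod_of_monic _ _ fun t _ => monic_X_sub_C _]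
    simp only [natDegree_X_sub_C, Finset.sum_const, Finset.card_range, smul_eq_mul, mul_one]
  have hs : (geomForm L m).Splits := by
    rw [h2]
    exact Splits.prod fun t _ => Splits.X_sub_C _
  have hr : (geomForm L m).roots =
      (Finset.range (m - 1)).val.map fun t => C (ζ ^ (t + 1)) * X := by
    rw [h2]
    exact (roots_multiset_prod_X_sub_C ((Finset.range (m - 1)).val.map
      fun t => C (ζ ^ (t + 1)) * X)) ▸ by simp [Finset.prod]
  have := resultant_eq_prod_eval (geomForm L m) (q.map C) d (natDegree_map_le.trans hq) hs
  rw [hdeg, hmonic.leadingCoeff, one_pow, one_mul, hr, Multiset.map_map] at this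
  rw [conjProd, this, Finset.prod]
  congr 1
  refine Multiset.map_congr rfl fun t _ => ?_
  simp only [Function.comp, eval_map, comp]

/-- `geomForm` has coefficients of degree `0`, so only the `m - 1` columns carrying `q` contribute.
-/
theorem conjProd_mem_homogeneousCoeffs {σ R : Type*} [CommRing R] (m d e : ℕ)
    {q : (MvPolynomial σ R)[X]} (hq : ∀ i, (q.coeff i).IsHomogeneous e) (i : ℕ) :
    ((conjProd m d q).coeff i).IsHomogeneous ((m - 1) * e) := by
  have h := resultant_mem_graded (homogeneousCoeffs σ R) (f := geomForm (MvPolynomial σ R) m)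
    (g := q.map C) (p := 0) (q := e) (fun i => ?_) (fun i => ?_) (m - 1) d
  · simpa [conjProd] using mem_homogeneousCoeffs.1 h i
  · rw [geomForm, finsetSum_coeff]
    refine sum_mem fun t _ j => ?_
    rw [← C_pow, coeff_mul_C, coeff_X_pow, ite_mul, one_mul, zero_mul]
    split_ifs
    · rw [coeff_X_pow]
      split_ifs
      exacts [MvPolynomial.isHomogeneous_one σ R, MvPolynomial.isHomogeneous_zero σ R 0]
    · simpa using MvPolynomial.isHomogeneous_zero σ R 0
  · intro j
    rw [coeff_map, coeff_C]
    split_ifs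
    exacts [hq i, MvPolynomial.isHomogeneous_zero σ R e]

/-! ### Nondegeneracy through resultants -/

/-- Over an algebraically closed field the resultant of `q` and `g` vanishes exactly when the two
have a common root. -/
theorem resultant_ne_zero_iff_of_isAlgClosed {L : Type*} [Field L] [IsAlgClosed L] {q g : L[X]}
    {d n : ℕ} (hq : q.natDegree = d) (hq0 : q ≠ 0) (hg : g.natDegree ≤ n) :
    resultant q g d n ≠ 0 ↔ ∀ x, q.IsRoot x → g.eval x ≠ 0 := by
  subst hq
  -- The exact degree of `q` makes the leading factor nonzero; only `g` may drop below its nominal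
  -- degree.
  rw [resultant_eq_prod_eval q g n hg (IsAlgClosed.splits q), mul_ne_zero_iff,
    and_iff_right (pow_ne_zero _ (leadingCoeff_ne_zero.2 hq0)), Ne, Multiset.prod_eq_zero_iff]
  simp only [Multiset.mem_map, mem_roots hq0, not_exists, not_and]

/-- A non-trivial resultant means that the two polynomials have no common root in the algebraic
closure. -/
theorem resultant_ne_zero_iff {K : Type*} [Field K] {q g : K[X]}
    {d n : ℕ} (hq : q.natDegree = d) (hq0 : q ≠ 0)
    (hg : (g.map (algebraMap K (AlgebraicClosure K))).natDegree ≤ n) :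
    resultant q g d n ≠ 0 ↔
      ∀ x, (q.map (algebraMap K (AlgebraicClosure K))).IsRoot x →
        (g.map (algebraMap K (AlgebraicClosure K))).eval x ≠ 0 := by
  rw [← resultant_ne_zero_iff_of_isAlgClosed (d := d) (n := n) (by rw [natDegree_map, hq])
    (map_ne_zero hq0) hg, resultant_map_map, _root_.map_ne_zero]

theorem exists_isPrimitiveRoot {K : Type*} [Field K] {m : ℕ} (hm : (m : K) ≠ 0) :
    ∃ ζ : AlgebraicClosure K, IsPrimitiveRoot ζ m := by
  have : NeZero (m : AlgebraicClosure K) :=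
    ⟨by rw [← map_natCast (algebraMap K (AlgebraicClosure K))]; exact (_root_.map_ne_zero _).2 hm⟩
  exact HasEnoughRootsOfUnity.exists_primitiveRoot (AlgebraicClosure K) m

theorem natDegree_comp_C_mul_X_le {L : Type*} [Field L] (q : L[X]) (c : L) :
    (q.comp (C c * X)).natDegree ≤ q.natDegree :=
  natDegree_comp_le.trans <| (Nat.mul_le_mul_left _ ((natDegree_C_mul_le c X).trans natDegree_X_le)).trans (mul_one _).le

theorem natDegree_conjProd_le {K : Type*} [Field K] {m d : ℕ} (hm : (m : K) ≠ 0) {q : K[X]}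
    (hq : q.natDegree ≤ d) : (conjProd m d q).natDegree ≤ (m - 1) * d := by
  obtain ⟨ζ, hζ⟩ := exists_isPrimitiveRoot hm
  have hm0 : 0 < m := Nat.pos_of_ne_zero fun h => hm (by simp [h])
  rw [← natDegree_map (algebraMap K (AlgebraicClosure K)), map_conjProd,
    conjProd_eq_prod hm0 hζ _ (natDegree_map_le.trans hq)]
  refine (natDegree_prod_le _ _).trans ?_
  refine (Finset.sum_le_card_nsmul _ _ d fun t _ => ?_).trans (by simp)
  exact (natDegree_comp_C_mul_X_le _ _).trans (natDegree_map_le.trans hq)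

theorem isNondegenerate_iff_isRoot {K : Type*} [Field K] {d m : ℕ} {q : K[X]} :
    IsNondegenerate d m q ↔ q.degree = (d : WithBot ℕ) ∧
      (∀ x, (q.map (algebraMap K (AlgebraicClosure K))).IsRoot x → x ≠ 0) ∧
      ∀ x, (q.map (algebraMap K (AlgebraicClosure K))).IsRoot x →
        ∀ y, (q.map (algebraMap K (AlgebraicClosure K))).IsRoot y → x = y ∨ x ^ m ≠ y ^ m := by
  refine and_congr_right fun hd => ?_
  have hq : q ≠ 0 := by
    rintro rfl
    simp at hd
  simp only [aroots_def, mem_roots (map_ne_zero (f := algebraMap K (AlgebraicClosure K)) hq)]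

/-- Nondegeneracy in terms of the conjugates `q(ζ^t x)`, `0 < t < m`. -/
theorem forall_root_pow_iff {L : Type*} [Field L] {m : ℕ} (hm : 0 < m) {ζ : L}
    (hζ : IsPrimitiveRoot ζ m) {q : L[X]} (h0 : ∀ x, q.IsRoot x → x ≠ 0) :
    (∀ x, q.IsRoot x → ∀ y, q.IsRoot y → x = y ∨ x ^ m ≠ y ^ m) ↔
      ∀ x, q.IsRoot x → ∀ t ∈ Finset.range (m - 1), q.eval (ζ ^ (t + 1) * x) ≠ 0 := by
  constructor
  · intro h x hx t ht h1
    rw [Finset.mem_range] at ht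
    rcases h x hx _ h1 with h2 | h2
    · exact hζ.pow_ne_one_of_pos_of_lt (by lia) (by lia : t + 1 < m)
        (mul_right_cancel₀ (h0 x hx) (by rw [one_mul, ← h2]))
    · apply h2
      rw [mul_pow, ← pow_mul, mul_comm (t + 1), pow_mul, hζ.pow_eq_one, one_pow, one_mul]
  · intro h x hx y hy
    rw [or_iff_not_imp_right, not_not]
    intro hxy
    have : NeZero m := ⟨hm.ne'⟩
    obtain ⟨i, hi, hi'⟩ := hζ.eq_pow_of_pow_eq_one (ξ := y / x)
      (by rw [div_pow, hxy, div_self (pow_ne_zero _ (h0 y hy))])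
    have hyx : y = ζ ^ i * x := by rw [hi', div_mul_cancel₀ _ (h0 x hx)]
    -- Exponent `0` gives `x = y`; a positive one would make `y` a forbidden conjugate root.
    rcases i with _ | i
    · simpa using hyx.symm
    · refine absurd ?_ (h x hx i (Finset.mem_range.2 (by lia)))
      rw [← hyx]
      exact hy

theorem isNondegenerate_iff {K : Type*} [Field K] {d m : ℕ} (hm : (m : K) ≠ 0) {q : K[X]}
    (hq : q.natDegree ≤ d) :
    IsNondegenerate d m q ↔
      q.coeff d ≠ 0 ∧ q.coeff 0 ≠ 0 ∧ resultant q (conjProd m d q) d ((m - 1) * d) ≠ 0 := by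
  obtain ⟨ζ, hζ⟩ := exists_isPrimitiveRoot hm
  have hm0 : 0 < m := Nat.pos_of_ne_zero fun h => hm (by simp [h])
  rw [isNondegenerate_iff_isRoot]
  have hdeg : q.degree = d ↔ q.coeff d ≠ 0 :=
    ⟨fun h => coeff_ne_zero_of_eq_degree h,
      fun h => degree_eq_of_le_of_coeff_ne_zero (natDegree_le_iff_degree_le.1 hq) h⟩
  rw [hdeg]
  refine and_congr_right fun hd => ?_
  have hq' : q.natDegree = d := natDegree_eq_of_degree_eq_some (hdeg.2 hd)
  have hq0 : q ≠ 0 := by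
    rintro rfl
    simp at hd
  have h0 : (∀ x, (q.map (algebraMap K (AlgebraicClosure K))).IsRoot x → x ≠ 0) ↔
      q.coeff 0 ≠ 0 := by
    have : (q.map (algebraMap K (AlgebraicClosure K))).IsRoot 0 ↔ q.coeff 0 = 0 := by
      rw [IsRoot, ← coeff_zero_eq_eval_zero, coeff_map, map_eq_zero]
    rw [Ne, ← this]
    exact ⟨fun h h' => h 0 h' rfl, fun h x hx hx0 => h (hx0 ▸ hx)⟩
  rw [resultant_ne_zero_iff hq' hq0
    (natDegree_map_le.trans (natDegree_conjProd_le hm hq)), ← h0]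
  refine and_congr_right fun h0 => ?_
  rw [forall_root_pow_iff hm0 hζ h0, map_conjProd,
    conjProd_eq_prod hm0 hζ _ (natDegree_map_le.trans hq)]
  simp [eval_prod, Finset.prod_ne_zero_iff]

/-! ### The hypersurface -/

/-- The polynomial whose non-vanishing locus is the nondegenerate part of `Rat_d`. -/
noncomputable def nondegPoly (d m : ℕ) : MvPolynomial (Coord d) ℤ :=
  let a : (MvPolynomial (Coord d) ℤ)[X] := binaryForm fun i => MvPolynomial.X (Sum.inl i)
  let b : (MvPolynomial (Coord d) ℤ)[X] := binaryForm fun i => MvPolynomial.X (Sum.inr i)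
  resultant a b d d * (b.coeff d * (b.coeff 0 * resultant b (conjProd m d b) d ((m - 1) * d)))

theorem isHomogeneous_nondegPoly (d m : ℕ) :
    ∃ n, 0 < n ∧ (nondegPoly d m).IsHomogeneous n := by
  have h (f : Fin (d + 1) → Coord d) (i : ℕ) :
      ((binaryForm fun i => (MvPolynomial.X (f i) : MvPolynomial (Coord d) ℤ)).coeff i)
        ∈ MvPolynomial.homogeneousSubmodule (Coord d) ℤ 1 := by
    rw [MvPolynomial.mem_homogeneousSubmodule, coeff_binaryForm]
    split_ifs
    exacts [MvPolynomial.isHomogeneous_X _ _, MvPolynomial.isHomogeneous_zero _ _ _]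
  refine ⟨_, ?_, (resultant_mem_graded _ (h Sum.inl) (h Sum.inr) d d).mul
    (MvPolynomial.IsHomogeneous.mul (h Sum.inr d) (MvPolynomial.IsHomogeneous.mul (h Sum.inr 0)
    (resultant_mem_graded (MvPolynomial.homogeneousSubmodule (Coord d) ℤ) (h Sum.inr)
      (conjProd_mem_homogeneousCoeffs m d 1 (h Sum.inr)) d ((m - 1) * d))))⟩
  -- The coordinates `b.coeff d` and `b.coeff 0` contribute `1` each, so the degree is positive even
  -- for `d = 0`.
  lia

theorem natDegree_form_le {K : Type*} [Field K] {d : ℕ} (c : Fin (d + 1) → K) :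
    (form c).natDegree ≤ d :=
  natDegree_binaryForm_le c

theorem eval_nondegPoly_ne_zero_iff {K : Type*} [Field K] {d m : ℕ} (hm : (m : K) ≠ 0)
    (v : Coord d → K) :
    MvPolynomial.eval v (MvPolynomial.map (Int.castRingHom K) (nondegPoly d m)) ≠ 0 ↔
      resultant (form fun i => v (Sum.inl i)) (form fun i => v (Sum.inr i)) d d ≠ 0 ∧
        IsNondegenerate d m (form fun i => v (Sum.inr i)) := by
  rw [isNondegenerate_iff hm (natDegree_form_le _)]
  let φ : MvPolynomial (Coord d) ℤ →+* K :=
    (MvPolynomial.eval v).comp (MvPolynomial.map (Int.castRingHom K))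
  have hφ (f : Fin (d + 1) → Coord d) :
      (binaryForm fun i => (MvPolynomial.X (f i) : MvPolynomial (Coord d) ℤ)).map φ =
        form fun i => v (f i) := by
    rw [map_binaryForm]
    simp [φ, form, binaryForm]
  change φ (nondegPoly d m) ≠ 0 ↔ _
  -- With the nominal degrees fixed, a resultant is one determinant in the coefficients, so it
  -- specializes even where leading coefficients vanish.
  have h1 := resultant_map_map (binaryForm fun i => (MvPolynomial.X (Sum.inl i : Coord d)))
    (binaryForm fun i => (MvPolynomial.X (Sum.inr i : Coord d))) d d φ
  have h2 := resultant_map_map (binaryForm fun i => (MvPolynomial.X (Sum.inr i : Coord d)))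
    (conjProd m d (binaryForm fun i => (MvPolynomial.X (Sum.inr i : Coord d)))) d ((m - 1) * d) φ
  rw [map_conjProd, hφ] at h2
  rw [hφ, hφ] at h1
  simp only [nondegPoly, map_mul, ← h1, ← h2, ← coeff_map, hφ, mul_ne_zero_iff]

theorem exists_form_eq {K : Type*} [Field K] {d : ℕ} {p q : K[X]} (hp : p.natDegree ≤ d)
    (hq : q.natDegree ≤ d) :
    ∃ v : Coord d → K, (form fun i => v (Sum.inl i)) = p ∧ (form fun i => v (Sum.inr i)) = q :=
  ⟨Sum.elim (fun i => p.coeff (d - i)) (fun i => q.coeff (d - i)), binaryForm_coeff p hp,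
    binaryForm_coeff q hq⟩

/-- The point `z^d / (z - 1)^d` lies off the hypersurface over every such field: the denominator has
no root other than `1`. -/
theorem map_nondegPoly_ne_zero {K : Type*} [Field K] {d m : ℕ} (hm : (m : K) ≠ 0) :
    MvPolynomial.map (Int.castRingHom K) (nondegPoly d m) ≠ 0 := by
  intro h
  obtain ⟨v, ha, hb⟩ := exists_form_eq (p := (X : K[X]) ^ d) (q := (X - C 1) ^ d) (d := d)
    (natDegree_X_pow d).le (by rw [natDegree_pow, natDegree_X_sub_C, mul_one])
  refine (eval_nondegPoly_ne_zero_iff hm v).2 ?_ (by rw [h, map_zero])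
  rw [ha, hb]
  constructor
  · have := resultant_ne_zero ((X : K[X]) ^ d) ((X - C 1 : K[X]) ^ d)
      (IsCoprime.pow ⟨1, -1, by simp⟩)
    rwa [natDegree_X_pow, natDegree_pow, natDegree_X_sub_C, mul_one] at this
  · have h1 (x) (hx : (((X - C 1 : K[X]) ^ d).map
        (algebraMap K (AlgebraicClosure K))).IsRoot x) : x = 1 := by
      simp only [Polynomial.map_pow, Polynomial.map_sub, map_X, IsRoot, eval_pow,
        eval_sub, eval_X, map_one, Polynomial.map_one, eval_one] at hx
      exact sub_eq_zero.1 (eq_zero_of_pow_eq_zero hx)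
    rw [isNondegenerate_iff_isRoot]
    refine ⟨?_, fun x hx => ?_, fun x hx y hy => ?_⟩
    · rw [degree_pow, degree_X_sub_C, nsmul_one]
    · rw [h1 x hx]
      exact one_ne_zero
    · exact Or.inl ((h1 x hx).trans (h1 y hy).symm)

/-! ### Substitution and lowest terms -/

section Subst

variable {K : Type*} [Field K]

local notation "ι" => algebraMap K (AlgebraicClosure K)

theorem eval₂_algebraMap_eq_comp (p : K[X]) (w : (AlgebraicClosure K)[X]) :
    p.eval₂ (RatFunc.C.comp ι) (algebraMap _ (RatFunc (AlgebraicClosure K)) w) =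
      algebraMap _ (RatFunc (AlgebraicClosure K)) ((p.map ι).comp w) := by
  rw [comp, eval₂_map, hom_eval₂, ← RatFunc.algebraMap_comp_C, RingHom.comp_assoc]

theorem subst_algebraMap (φ : RatFunc K) (w : (AlgebraicClosure K)[X]) :
    subst φ (algebraMap _ (RatFunc (AlgebraicClosure K)) w) =
      algebraMap _ (RatFunc (AlgebraicClosure K)) ((φ.num.map ι).comp w) /
        algebraMap _ (RatFunc (AlgebraicClosure K)) ((φ.denom.map ι).comp w) := by
  rw [subst, RatFunc.eval, eval₂_algebraMap_eq_comp, eval₂_algebraMap_eq_comp]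

/-- `RatFunc.eval` uses the reduced fraction; this allows any fraction whose denominator survives
the substitution. -/
theorem subst_div (p : K[X]) {q : K[X]} {w : (AlgebraicClosure K)[X]}
    (hq : (q.map ι).comp w ≠ 0) :
    subst (algebraMap K[X] (RatFunc K) p / algebraMap K[X] (RatFunc K) q)
        (algebraMap _ (RatFunc (AlgebraicClosure K)) w) =
      algebraMap _ (RatFunc (AlgebraicClosure K)) ((p.map ι).comp w) /
        algebraMap _ (RatFunc (AlgebraicClosure K)) ((q.map ι).comp w) := by
  have hq0 : q ≠ 0 := by
    rintro rfl
    simp at hq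
  set φ := algebraMap K[X] (RatFunc K) p / algebraMap K[X] (RatFunc K) q with hφ
  have h1 : φ.num * q = p * φ.denom := (RatFunc.num_mul_eq_mul_denom_iff hq0).2 hφ
  have h2 : (φ.denom.map ι).comp w ≠ 0 := by
    obtain ⟨r, hr⟩ := RatFunc.denom_div_dvd p q
    intro h
    apply hq
    rw [hr, Polynomial.map_mul, mul_comp, ← hφ, h, zero_mul]
  rw [subst_algebraMap, div_eq_div_iff (RatFunc.algebraMap_ne_zero h2)
    (RatFunc.algebraMap_ne_zero hq), ← map_mul, ← map_mul, ← mul_comp, ← mul_comp,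
    ← Polynomial.map_mul, ← Polynomial.map_mul, h1]

theorem comp_X_pow_ne_zero {L : Type*} [Field L] {m : ℕ} (hm : 0 < m) {p : L[X]} (hp : p ≠ 0) :
    p.comp (X ^ m) ≠ 0 := by
  rw [← expand_eq_comp_X_pow]
  exact (expand_ne_zero hm).2 hp

/-- Substituting `w^m` is injective on rational functions. -/
theorem subst_X_pow_injective {m : ℕ} (hm : 0 < m) :
    Function.Injective fun φ : RatFunc K => subst φ (RatFunc.X ^ m) := by
  intro φ ψ h
  have hX : (RatFunc.X ^ m : RatFunc (AlgebraicClosure K)) =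
      algebraMap (AlgebraicClosure K)[X] (RatFunc (AlgebraicClosure K)) (X ^ m) := by
    rw [map_pow, RatFunc.algebraMap_X]
  have hne (χ : RatFunc K) : (χ.denom.map ι).comp (X ^ m) ≠ 0 :=
    comp_X_pow_ne_zero hm (Polynomial.map_ne_zero χ.denom_ne_zero)
  simp only [hX, subst_algebraMap] at h
  rw [div_eq_div_iff (RatFunc.algebraMap_ne_zero (hne φ)) (RatFunc.algebraMap_ne_zero (hne ψ)),
    ← map_mul, ← map_mul, ← mul_comp, ← mul_comp, ← Polynomial.map_mul,
    ← Polynomial.map_mul] at h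
  have h1 := map_injective _ (algebraMap K (AlgebraicClosure K)).injective
    (expand_injective hm (RatFunc.algebraMap_injective _ h))
  rw [← RatFunc.num_div_denom φ, ← RatFunc.num_div_denom ψ,
    div_eq_div_iff (RatFunc.algebraMap_ne_zero φ.denom_ne_zero)
      (RatFunc.algebraMap_ne_zero ψ.denom_ne_zero), ← map_mul, ← map_mul, h1]

end Subst

theorem isCoprime_iff_of_isAlgClosure {K : Type*} [Field K] {p q : K[X]} :
    IsCoprime p q ↔ ∀ x, (q.map (algebraMap K (AlgebraicClosure K))).IsRoot x →
      (p.map (algebraMap K (AlgebraicClosure K))).eval x ≠ 0 := by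
  rw [← isCoprime_map (algebraMap K (AlgebraicClosure K)),
    isCoprime_iff_aeval_ne_zero_of_isAlgClosed (AlgebraicClosure K) (AlgebraicClosure K)]
  refine forall_congr' fun x => ?_
  rw [coe_aeval_eq_eval, IsRoot, or_comm, or_iff_not_imp_left, not_not]

/-- A fraction in lowest terms with denominator of degree `d` and numerator of degree at most `d`
has degree `d`. -/
theorem ratDegree_div_of_isCoprime {K : Type*} [Field K] {p q : K[X]} (h : IsCoprime p q)
    (hq : q ≠ 0) (hpq : p.natDegree ≤ q.natDegree) :
    ratDegree (algebraMap K[X] (RatFunc K) p / algebraMap K[X] (RatFunc K) q) = q.natDegree := by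
  set φ := algebraMap K[X] (RatFunc K) p / algebraMap K[X] (RatFunc K) q with hφ
  have h1 : φ.num * q = p * φ.denom := (RatFunc.num_mul_eq_mul_denom_iff hq).2 hφ
  have h2 : q ∣ φ.denom := h.symm.dvd_of_dvd_mul_left ⟨φ.num, by rw [← h1, mul_comm]⟩
  have hd : φ.denom.natDegree = q.natDegree :=
    le_antisymm (natDegree_le_of_dvd (RatFunc.denom_div_dvd p q) hq)
      (natDegree_le_of_dvd h2 φ.denom_ne_zero)
  have hn : φ.num.natDegree ≤ p.natDegree := by
    rcases eq_or_ne p 0 with rfl | hp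
    · rw [hφ, map_zero, zero_div, RatFunc.num_zero]
    · exact natDegree_le_of_dvd (RatFunc.num_div_dvd p hq) hp
  rw [ratDegree, hd, max_eq_right (hn.trans hpq)]

/-! ### Extracting exponents in a residue class -/

section Multisection

variable {R : Type*} [CommRing R]

/-- The polynomial with coefficients `f_(nm+k)`. -/
noncomputable def multisection (m k : ℕ) (f : R[X]) : R[X] := contract m (divX^[k] f)

theorem coeff_iterate_divX (k : ℕ) (f : R[X]) (n : ℕ) :
    (divX^[k] f).coeff n = f.coeff (n + k) := by
  induction k generalizing n with
  | zero => rfl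
  | succ k ih => rw [Function.iterate_succ_apply', coeff_divX, ih, add_right_comm, add_assoc]

theorem coeff_multisection {m : ℕ} (hm : m ≠ 0) (k : ℕ) (f : R[X]) (n : ℕ) :
    (multisection m k f).coeff n = f.coeff (n * m + k) := by
  rw [multisection, coeff_contract hm, coeff_iterate_divX]

theorem map_multisection {S : Type*} [CommRing S] (φ : R →+* S) {m : ℕ} (hm : m ≠ 0) (k : ℕ)
    (f : R[X]) : (multisection m k f).map φ = multisection m k (f.map φ) := by
  ext n
  simp only [coeff_map, coeff_multisection hm]

theorem natDegree_multisection_le {m d k : ℕ} (hm : m ≠ 0) {f : R[X]} (hf : f.natDegree ≤ m * d) :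
    (multisection m k f).natDegree ≤ d := by
  refine natDegree_le_iff_coeff_eq_zero.2 fun n hn => ?_
  rw [coeff_multisection hm]
  refine coeff_eq_zero_of_natDegree_lt (hf.trans_lt ?_)
  rw [mul_comm]
  exact (Nat.mul_lt_mul_of_pos_right hn (Nat.pos_of_ne_zero hm)).trans_le (Nat.le_add_right _ _)

end Multisection

/-! ### Averages over roots of unity -/

section RootsOfUnity

variable {L : Type*} [Field L] {m : ℕ} {ζ : L}

/-- A geometric sum of ratio `ζ^(n-k)`, which is `1` exactly when `n ≡ k` modulo `m`. -/
theorem sum_inv_pow_mul_pow (hm : 0 < m) (hζ : IsPrimitiveRoot ζ m) (k n : ℕ) :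
    ∑ t ∈ Finset.range m, (ζ ^ (k * t))⁻¹ * (ζ ^ t) ^ n = if n ≡ k [MOD m] then (m : L) else 0 := by
  have h0 : ζ ≠ 0 := hζ.ne_zero hm.ne'
  have h1 (t : ℕ) : (ζ ^ (k * t))⁻¹ * (ζ ^ t) ^ n = (ζ ^ n / ζ ^ k) ^ t := by
    rw [div_pow, ← pow_mul, ← pow_mul, ← pow_mul, mul_comm n t, mul_comm, div_eq_mul_inv]
  simp_rw [h1]
  split_ifs with h
  · have : ζ ^ n / ζ ^ k = 1 := by
      rw [div_eq_one_iff_eq (pow_ne_zero _ h0), (hζ.isOfFinOrder hm.ne').pow_eq_pow_iff_modEq, ← hζ.eq_orderOf]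
      exact h
    simp [this]
  · have hne : ζ ^ n / ζ ^ k ≠ 1 := by
      rwa [Ne, div_eq_one_iff_eq (pow_ne_zero _ h0), (hζ.isOfFinOrder hm.ne').pow_eq_pow_iff_modEq, ← hζ.eq_orderOf]
    rw [geom_sum_eq hne, div_pow, ← pow_mul, ← pow_mul, mul_comm n, mul_comm k, pow_mul, pow_mul,
      hζ.pow_eq_one, one_pow, one_pow, div_one, sub_self, zero_div]

/-- Averaging over the roots of unity extracts the exponents congruent to `k`. -/
theorem sum_comp_eq_multisection (hm : 0 < m) (hζ : IsPrimitiveRoot ζ m) {k : ℕ} (hk : k < m)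
    (f : L[X]) :
    ∑ t ∈ Finset.range m, C (ζ ^ (k * t))⁻¹ * f.comp (C (ζ ^ t) * X) =
      (m : L[X]) * X ^ k * expand L m (multisection m k f) := by
  ext n
  simp only [finsetSum_coeff, coeff_C_mul, comp_C_mul_X_coeff]
  have h1 (t : ℕ) : (ζ ^ (k * t))⁻¹ * (f.coeff n * (ζ ^ t) ^ n) =
      f.coeff n * ((ζ ^ (k * t))⁻¹ * (ζ ^ t) ^ n) := by ring
  simp_rw [h1]
  rw [← Finset.mul_sum, sum_inv_pow_mul_pow hm hζ, mul_assoc, coeff_natCast_mul, coeff_X_pow_mul',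
    coeff_expand hm]
  by_cases hkn : k ≤ n
  · obtain ⟨j, rfl⟩ := Nat.exists_eq_add_of_le hkn
    have h2 : k + j ≡ k [MOD m] ↔ m ∣ j := Nat.add_modEq_left_iff
    simp only [h2, if_pos hkn, Nat.add_sub_cancel_left]
    split_ifs with h
    · rw [coeff_multisection hm.ne', Nat.div_mul_cancel h, add_comm k, mul_comm]
    · simp
  -- Here `k < m` is essential: no exponent below `k` is congruent to `k`, so `X^k` divides the sum.
  · have h2 : ¬ n ≡ k [MOD m] := fun h => by
      have := Nat.ModEq.eq_of_lt_of_lt h (by lia) hk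
      lia
    rw [if_neg h2, if_neg hkn, mul_zero, mul_zero]

/-- A polynomial invariant under `x ↦ ζ x` is a polynomial in `x^m`. -/
theorem expand_contract_of_comp_eq (hm : 0 < m) (hζ : IsPrimitiveRoot ζ m) {f : L[X]}
    (hf : f.comp (C ζ * X) = f) : expand L m (contract m f) = f := by
  ext n
  rw [coeff_expand hm]
  split_ifs with h
  · rw [coeff_contract hm.ne', Nat.div_mul_cancel h]
  · by_contra hn
    have h1 := congrArg (fun g => g.coeff n) hf
    simp only [comp_C_mul_X_coeff] at h1
    exact h (hζ.dvd_of_pow_eq_one n (mul_left_cancel₀ (Ne.symm hn) (by rw [h1, mul_one])))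

theorem mul_conjProd_eq_prod (hm : 0 < m) (hζ : IsPrimitiveRoot ζ m) {q : L[X]} {d : ℕ}
    (hq : q.natDegree ≤ d) :
    q * conjProd m d q = ∏ t ∈ Finset.range m, q.comp (C (ζ ^ t) * X) := by
  obtain ⟨m, rfl⟩ : ∃ m', m = m' + 1 := ⟨m - 1, by lia⟩
  rw [conjProd_eq_prod hm hζ q hq, Finset.prod_range_succ', mul_comm]
  simp

/-- The substitution `x ↦ ζx` permutes the `m` factors cyclically. -/
theorem mul_conjProd_comp (hm : 0 < m) (hζ : IsPrimitiveRoot ζ m) {q : L[X]} {d : ℕ}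
    (hq : q.natDegree ≤ d) :
    (q * conjProd m d q).comp (C ζ * X) = q * conjProd m d q := by
  rw [mul_conjProd_eq_prod hm hζ hq, prod_comp]
  have h1 (t : ℕ) : (q.comp (C (ζ ^ t) * X)).comp (C ζ * X) = q.comp (C (ζ ^ (t + 1)) * X) := by
    rw [comp_assoc, mul_comp, C_comp, X_comp, ← mul_assoc, ← C_mul, ← pow_succ]
  simp_rw [h1]
  obtain ⟨m, rfl⟩ : ∃ m', m = m' + 1 := ⟨m - 1, by lia⟩
  rw [Finset.prod_range_succ, Finset.prod_range_succ', hζ.pow_eq_one, pow_zero]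

end RootsOfUnity

/-! ### The Landen transform and its degree -/

section LandenTransform

variable {K : Type*} [Field K]

local notation "ι" => algebraMap K (AlgebraicClosure K)

theorem isNondegenerate_natDegree {d m : ℕ} {q : K[X]} (h : IsNondegenerate d m q) :
    q.natDegree = d :=
  natDegree_eq_of_degree_eq_some h.1

/-- The denominator of the Landen transform: its roots are the `m`-th powers of the roots of `q`. -/
noncomputable def powForm (m d : ℕ) (q : K[X]) : K[X] := contract m (q * conjProd m d q)

theorem expand_powForm {d m : ℕ} (hm : (m : K) ≠ 0) {q : K[X]} (hq : q.natDegree ≤ d) :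
    expand K m (powForm m d q) = q * conjProd m d q := by
  obtain ⟨ζ, hζ⟩ := exists_isPrimitiveRoot hm
  have hm0 : 0 < m := Nat.pos_of_ne_zero fun h => hm (by simp [h])
  apply map_injective ι (algebraMap K (AlgebraicClosure K)).injective
  have hq' : (q.map ι).natDegree ≤ d := natDegree_map_le.trans hq
  rw [powForm, map_expand, map_contract hm0.ne', Polynomial.map_mul, map_conjProd,
    expand_contract_of_comp_eq hm0 hζ (mul_conjProd_comp hm0 hζ hq')]

theorem natDegree_comp_C_mul_X {L : Type*} [Field L] (q : L[X]) {c : L} (hc : c ≠ 0) :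
    (q.comp (C c * X)).natDegree = q.natDegree := by
  rw [natDegree_comp, natDegree_C_mul_X c hc, mul_one]

theorem comp_C_mul_X_ne_zero {L : Type*} [Field L] {q : L[X]} (hq : q ≠ 0) {c : L} (hc : c ≠ 0) :
    q.comp (C c * X) ≠ 0 := by
  intro h
  apply hq
  have h1 := congrArg (fun r => r.comp (C c⁻¹ * X)) h
  simpa [comp_assoc, ← mul_assoc, ← C_mul, hc] using h1

theorem natDegree_powForm {d m : ℕ} (hm : (m : K) ≠ 0) {q : K[X]} (hq : q.natDegree = d)
    (hq0 : q ≠ 0) : (powForm m d q).natDegree = d := by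
  obtain ⟨ζ, hζ⟩ := exists_isPrimitiveRoot hm
  have hm0 : 0 < m := Nat.pos_of_ne_zero fun h => hm (by simp [h])
  have hζ0 (t : ℕ) : ζ ^ t ≠ 0 := pow_ne_zero _ (hζ.ne_zero hm0.ne')
  have hq' : (q.map ι).natDegree = d := by rw [natDegree_map, hq]
  have h : (powForm m d q).natDegree * m = d * m := by
    rw [← natDegree_expand, expand_powForm hm hq.le, ← natDegree_map ι, Polynomial.map_mul,
      map_conjProd, mul_conjProd_eq_prod hm0 hζ hq'.le, natDegree_prod _ _ fun t _ =>
        comp_C_mul_X_ne_zero (Polynomial.map_ne_zero hq0) (hζ0 t)]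
    simp only [natDegree_comp_C_mul_X _ (hζ0 _), hq', Finset.sum_const, Finset.card_range,
      smul_eq_mul]
    exact mul_comm m d
  exact Nat.eq_of_mul_eq_mul_right hm0 h

theorem powForm_ne_zero {d m : ℕ} (hm : (m : K) ≠ 0) {q : K[X]} (hq : q.natDegree = d)
    (hq0 : q ≠ 0) : powForm m d q ≠ 0 := by
  obtain ⟨ζ, hζ⟩ := exists_isPrimitiveRoot hm
  have hm0 : 0 < m := Nat.pos_of_ne_zero fun h => hm (by simp [h])
  have hζ0 (t : ℕ) : ζ ^ t ≠ 0 := pow_ne_zero _ (hζ.ne_zero hm0.ne')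
  have hq' : (q.map ι).natDegree = d := by rw [natDegree_map, hq]
  rw [← expand_ne_zero hm0, expand_powForm hm hq.le,
    ← Polynomial.map_ne_zero_iff (algebraMap K (AlgebraicClosure K)).injective,
    Polynomial.map_mul, map_conjProd, mul_conjProd_eq_prod hm0 hζ hq'.le]
  exact Finset.prod_ne_zero_iff.2 fun t _ =>
    comp_C_mul_X_ne_zero (Polynomial.map_ne_zero hq0) (hζ0 t)

/-- The numerator of the Landen transform. -/
noncomputable def landenNumer (m k d : ℕ) (p q : K[X]) : K[X] :=
  multisection m k (p * conjProd m d q)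

theorem expand_comp_C_mul_X {L : Type*} [Field L] {m : ℕ} {c : L} (hc : c ^ m = 1) (f : L[X]) :
    (expand L m f).comp (C c * X) = expand L m f := by
  rw [expand_eq_comp_X_pow, comp_assoc, pow_comp, X_comp, mul_pow, ← C_pow, hc, C_1, one_mul]

/-- The Landen transform as an explicit fraction. -/
theorem isLandenTransform_div {d m k : ℕ} (hm : (m : K) ≠ 0) (hk : k < m) (p : K[X]) {q : K[X]}
    (hq : q.natDegree = d) (hq0 : q ≠ 0) :
    IsLandenTransform m k (algebraMap K[X] (RatFunc K) p / algebraMap K[X] (RatFunc K) q)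
      (algebraMap K[X] (RatFunc K) (landenNumer m k d p q) /
        algebraMap K[X] (RatFunc K) (powForm m d q)) := by
  intro ζ hζ
  have hm0 : 0 < m := Nat.pos_of_ne_zero fun h => hm (by simp [h])
  have hmL : (m : RatFunc (AlgebraicClosure K)) ≠ 0 := by
    rw [← map_natCast ((RatFunc.C).comp ι)]
    exact (_root_.map_ne_zero _).2 hm
  have hζ0 (t : ℕ) : ζ ^ t ≠ 0 := pow_ne_zero _ (hζ.ne_zero hm0.ne')
  have hqL : q.map ι ≠ 0 := Polynomial.map_ne_zero hq0
  have hH : (powForm m d q).map ι ≠ 0 := Polynomial.map_ne_zero (powForm_ne_zero hm hq hq0)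
  have hHe : expand _ m ((powForm m d q).map ι) ≠ 0 := (expand_ne_zero hm0).2 hH
  have hqG : expand _ m ((powForm m d q).map ι) = q.map ι * (conjProd m d q).map ι := by
    rw [← map_expand, expand_powForm hm hq.le, Polynomial.map_mul]
  have hterm (t : ℕ) :
      subst (algebraMap K[X] (RatFunc K) p / algebraMap K[X] (RatFunc K) q)
        (RatFunc.C (ζ ^ t) * RatFunc.X) =
      algebraMap _ (RatFunc (AlgebraicClosure K))
          (((p * conjProd m d q).map ι).comp (C (ζ ^ t) * X)) /
        algebraMap _ (RatFunc (AlgebraicClosure K)) (expand _ m ((powForm m d q).map ι)) := by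
    have hw : RatFunc.C (ζ ^ t) * RatFunc.X =
        algebraMap (AlgebraicClosure K)[X] (RatFunc (AlgebraicClosure K)) (C (ζ ^ t) * X) := by
      rw [map_mul, RatFunc.algebraMap_C, RatFunc.algebraMap_X]
    have hqt := comp_C_mul_X_ne_zero hqL (hζ0 t)
    -- The denominator `H(w^m)` is unchanged by `w ↦ ζ^t w`, so it is common to all terms.
    rw [hw, subst_div p hqt, div_eq_div_iff (RatFunc.algebraMap_ne_zero hqt)
      (RatFunc.algebraMap_ne_zero hHe), ← map_mul, ← map_mul,
      ← expand_comp_C_mul_X (c := ζ ^ t) (by rw [← pow_mul, mul_comm, pow_mul, hζ.pow_eq_one,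
        one_pow]), hqG, Polynomial.map_mul, mul_comp, mul_comp]
    congr 1
    ring
  have hX : (RatFunc.X ^ m : RatFunc (AlgebraicClosure K)) =
      algebraMap (AlgebraicClosure K)[X] (RatFunc (AlgebraicClosure K)) (X ^ m) := by
    rw [map_pow, RatFunc.algebraMap_X]
  have hsum := congrArg (algebraMap (AlgebraicClosure K)[X] (RatFunc (AlgebraicClosure K)))
    (sum_comp_eq_multisection hm0 hζ hk ((p * conjProd m d q).map ι))
  rw [map_sum] at hsum
  simp_rw [hterm]
  rw [hX, subst_div _ (comp_X_pow_ne_zero hm0 hH), ← expand_eq_comp_X_pow, ← expand_eq_comp_X_pow,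
    landenNumer, map_multisection ι hm0.ne']
  simp_rw [← mul_div_assoc]
  rw [← Finset.sum_div]
  simp_rw [← RatFunc.algebraMap_C, ← map_mul]
  rw [hsum, map_mul, map_mul, map_natCast, map_pow, RatFunc.algebraMap_X]
  have hXk : (RatFunc.X ^ k : RatFunc (AlgebraicClosure K)) ≠ 0 := pow_ne_zero _ RatFunc.X_ne_zero
  field_simp

theorem isCoprime_landenNumer {d m k : ℕ} (hm : (m : K) ≠ 0) (hk : k < m) {p q : K[X]}
    (hpq : IsCoprime p q) (hq : IsNondegenerate d m q) :
    IsCoprime (landenNumer m k d p q) (powForm m d q) := by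
  obtain ⟨ζ, hζ⟩ := exists_isPrimitiveRoot hm
  have hm0 : 0 < m := Nat.pos_of_ne_zero fun h => hm (by simp [h])
  have hqd := isNondegenerate_natDegree hq
  obtain ⟨-, h0, h1⟩ := isNondegenerate_iff_isRoot.1 hq
  rw [forall_root_pow_iff hm0 hζ h0] at h1
  rw [isCoprime_iff_of_isAlgClosure] at hpq ⊢
  have hqd' : (q.map ι).natDegree ≤ d := natDegree_map_le.trans hqd.le
  have hqG : expand _ m ((powForm m d q).map ι) = q.map ι * (conjProd m d q).map ι := by
    rw [← map_expand, expand_powForm hm hqd.le, Polynomial.map_mul]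
  intro z hz hN
  obtain ⟨y, rfl⟩ := IsAlgClosed.exists_pow_nat_eq z hm0
  -- Some conjugate of `y` is a root of `q`.
  obtain ⟨x, hxy, hx⟩ : ∃ x, x ^ m = y ^ m ∧ (q.map ι).IsRoot x := by
    have h2 : (q.map ι * (conjProd m d q).map ι).eval y = 0 := by
      rw [← hqG, expand_eval]
      exact hz
    rw [map_conjProd, mul_conjProd_eq_prod hm0 hζ hqd', eval_prod, Finset.prod_eq_zero_iff] at h2
    obtain ⟨t, -, ht⟩ := h2
    refine ⟨ζ ^ t * y, ?_, by simpa using ht⟩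
    rw [mul_pow, ← pow_mul, mul_comm t, pow_mul, hζ.pow_eq_one, one_pow, one_mul]
  rw [← hxy] at hN
  -- If `N(x^m) = 0`, the whole average vanishes at `x`, while its `t = 0` term `p(x) G(x)` does
  -- not.
  have hsum := congrArg (eval x) (sum_comp_eq_multisection hm0 hζ hk ((p * conjProd m d q).map ι))
  rw [landenNumer, map_multisection ι hm0.ne'] at hN
  rw [eval_mul, expand_eval, hN, mul_zero, eval_finsetSum, Finset.sum_eq_single 0] at hsum
  · simp only [mul_zero, pow_zero, inv_one, C_1, one_mul, comp_X, Polynomial.map_mul,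
      eval_mul, mul_eq_zero, hpq x hx, false_or, map_conjProd,
      conjProd_eq_prod hm0 hζ _ hqd', eval_prod, Finset.prod_eq_zero_iff] at hsum
    obtain ⟨t, ht, h3⟩ := hsum
    exact h1 x hx t ht (by simpa using h3)
  · intro t ht ht0
    rw [Finset.mem_range] at ht
    have h4 : ((conjProd m d q).map ι).eval (ζ ^ t * x) = 0 := by
      rw [map_conjProd, conjProd_eq_prod hm0 hζ _ hqd', eval_prod, Finset.prod_eq_zero_iff]
      -- The factor of `G` with exponent `m - t` takes `ζ^t x` back to the root `x`; `t ≠ 0` keeps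
      -- the index in range.
      refine ⟨m - t - 1, Finset.mem_range.2 (by lia), ?_⟩
      have h5 : ζ ^ (m - t - 1 + 1) * (ζ ^ t * x) = x := by
        rw [← mul_assoc, ← pow_add, show m - t - 1 + 1 + t = m by lia, hζ.pow_eq_one, one_mul]
      simpa [h5] using hx
    simp only [Polynomial.map_mul, eval_mul, eval_comp, eval_C, eval_X, h4, mul_zero]
  · intro h
    exact absurd (Finset.mem_range.2 hm0) h

theorem ratDegree_landen {d m k : ℕ} (hm : (m : K) ≠ 0) (hk : k < m) {p q : K[X]}
    (hp : p.natDegree ≤ d) (hpq : IsCoprime p q) (hq : IsNondegenerate d m q) (hq0 : q ≠ 0) :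
    ratDegree (algebraMap K[X] (RatFunc K) (landenNumer m k d p q) /
      algebraMap K[X] (RatFunc K) (powForm m d q)) = d := by
  have hm0 : 0 < m := Nat.pos_of_ne_zero fun h => hm (by simp [h])
  have hqd := isNondegenerate_natDegree hq
  have hH := natDegree_powForm hm hqd hq0
  rw [ratDegree_div_of_isCoprime (isCoprime_landenNumer hm hk hpq hq)
    (powForm_ne_zero hm hqd hq0), hH]
  rw [hH]
  refine natDegree_multisection_le hm0.ne' (natDegree_mul_le.trans ?_)
  refine (Nat.add_le_add hp (natDegree_conjProd_le hm hqd.le)).trans (le_of_eq ?_)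
  obtain ⟨m, rfl⟩ : ∃ m', m = m' + 1 := ⟨m - 1, by lia⟩
  simp only [Nat.add_sub_cancel]
  ring

theorem isCoprime_of_resultant_ne_zero {d : ℕ} {p q : K[X]} (hp : p.natDegree ≤ d)
    (hq : q.natDegree = d) (hq0 : q ≠ 0) (h : resultant p q d d ≠ 0) : IsCoprime p q := by
  -- Only `q` is known to have degree exactly `d`, so it must come first; the swap costs a sign.
  rw [resultant_comm, mul_ne_zero_iff,
    resultant_ne_zero_iff hq hq0 (natDegree_map_le.trans hp)] at h
  exact isCoprime_iff_of_isAlgClosure.2 h.2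

end LandenTransform

end Landen

theorem corollary20 (d m k : ℕ) (hm : 2 ≤ m) (hk : k < m) :
    (∃ (n : ℕ) (f : MvPolynomial (Landen.Coord d) ℤ), 0 < n ∧ f.IsHomogeneous n ∧
      ∀ (K : Type*) [Field K], (m : K) ≠ 0 →
        MvPolynomial.map (Int.castRingHom K) f ≠ 0 ∧
        Landen.RatNondeg K d m =
          (Landen.zeroLocus (MvPolynomial.map (Int.castRingHom K) f))ᶜ) ∧
    ∀ (K : Type*) [Field K], (m : K) ≠ 0 → ∀ P ∈ Landen.RatNondeg K d m,
      ∃ ψ : RatFunc K,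
        Landen.IsLandenTransform m k (Landen.ratFunc P) ψ ∧
        (∀ ψ' : RatFunc K, Landen.IsLandenTransform m k (Landen.ratFunc P) ψ' → ψ' = ψ) ∧
        Landen.ratDegree ψ = d := by
  constructor
  · obtain ⟨n, hn, hf⟩ := Landen.isHomogeneous_nondegPoly d m
    refine ⟨n, Landen.nondegPoly d m, hn, hf, fun K _ hmK =>
      ⟨Landen.map_nondegPoly_ne_zero hmK, Set.ext fun P => ?_⟩⟩
    -- Both sides are read off the same representative `P.rep`, so no independence of the choice is
    -- needed.
    exact (Landen.eval_nondegPoly_ne_zero_iff hmK P.rep).symm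
  · rintro K _ hmK P ⟨hP, hq⟩
    have hqd := Landen.isNondegenerate_natDegree hq
    have hq0 : Landen.denomin P ≠ 0 := by
      intro h
      have := hq.1
      simp [h] at this
    have hp : (Landen.numer P).natDegree ≤ d := Landen.natDegree_form_le _
    have hL := Landen.isLandenTransform_div hmK hk (Landen.numer P) hqd hq0
    refine ⟨_, hL, fun ψ' hψ' => ?_, Landen.ratDegree_landen hmK hk hp
      (Landen.isCoprime_of_resultant_ne_zero hp hqd hq0 hP) hq hq0⟩
    -- Without an actual primitive root the defining identity would be vacuous; one suffices for
    -- uniqueness.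
    obtain ⟨ζ, hζ⟩ := Landen.exists_isPrimitiveRoot hmK
    exact Landen.subst_X_pow_injective (by lia) ((hψ' ζ hζ).trans (hL ζ hζ).symm)
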